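/- For a finite group $G$ and an element $F=\sum_{g\in G}a_g g$ of the integral group ring $\mathbb Z[G]$ let $$M_G(F)=\det\left(a_{gh^{-1}}\right)_{g,h\in G}$$ be its group determinant, and define the Lind–Lehmer constant $$\lambda(G)=\frac{1}{|G|}\log\min\{|M_G(F)| : F\in\mathbb Z[G],\ |M_G(F)|\ge 2\}.$$ Let $p\ge 3$ be a prime and let $H_p$ be the Heisenberg group over $\mathbb Z_p=\mathbb Z/p\mathbb Z$, that is, the group of matrices $$\begin{pmatrix}1&a&c\\0&1&b\\0&0&1\end{pmatrix},\qquad a,b,c\in\mathbb Z_p,$$ under matrix multiplication. Then $$\lambda(H_p)=\lambda(\mathbb Z_p^3)=\frac{1}{p^3}\log\min\{x\in\mathbb Z : x\ge 2,\ x^{p-1}\equiv 1 \bmod p^3\}.$$ Indeed, the smallest value $|M_G(F)|\ge 2$ is the same for $G=H_p$ and for $G=\mathbb Z_p^3$, namely $\min\{x\ge 2 : x^{p-1}\equiv 1 \bmod p^3\}$. -/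

import Mathlib

/-- The group determinant of the element `F = ∑ a_g g` of the integral group ring `ℤ[G]`:
the determinant of the matrix with `(g, h)` entry `a_{g h⁻¹}`. -/
def groupDet {G : Type*} [Group G] [Fintype G] [DecidableEq G] (F : MonoidAlgebra ℤ G) : ℤ :=
  (Matrix.of fun g h : G => F.coeff (g * h⁻¹)).det

/-- The absolute values `|M_G(F)| ≥ 2` of the integer group determinants of `G`. -/
def nontrivialAbsDets (G : Type*) [Group G] [Fintype G] [DecidableEq G] : Set ℕ :=
  {n | 2 ≤ n ∧ ∃ F : MonoidAlgebra ℤ G, (groupDet F).natAbs = n}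

/-- The Lind–Lehmer constant `λ(G) = |G|⁻¹ log min {|M_G(F)| ≥ 2 : F ∈ ℤ[G]}`. -/
noncomputable def lindLehmer (G : Type*) [Group G] [Fintype G] [DecidableEq G] : ℝ :=
  1 / (Fintype.card G : ℝ) * Real.log ((sInf (nontrivialAbsDets G) : ℕ) : ℝ)

/-- The Heisenberg group over a commutative ring `R`: the upper unitriangular `3 × 3` matrices
under matrix multiplication. -/
def heisenberg (R : Type*) [CommRing R] : Subgroup (Matrix.SpecialLinearGroup (Fin 3) R) where
  carrier := {M | ∃ a b c : R, (M : Matrix (Fin 3) (Fin 3) R) = !![1, a, c; 0, 1, b; 0, 0, 1]}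
  one_mem' := ⟨0, 0, 0, by
    ext i j; fin_cases i <;> fin_cases j <;> simp⟩
  mul_mem' := by
    rintro M N ⟨a, b, c, hM⟩ ⟨a', b', c', hN⟩
    refine ⟨a + a', b + b', c + c' + a * b', ?_⟩
    rw [Matrix.SpecialLinearGroup.coe_mul, hM, hN]
    ext i j
    fin_cases i <;> fin_cases j <;> simp [Matrix.mul_apply, Fin.sum_univ_three] <;> ring
  inv_mem' := by
    rintro M ⟨a, b, c, hM⟩
    refine ⟨-a, -b, a * b - c, ?_⟩
    rw [Matrix.SpecialLinearGroup.coe_inv, hM, Matrix.adjugate_fin_three_of]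
    ext i j
    fin_cases i <;> fin_cases j <;> simp

noncomputable instance heisenbergFintype (R : Type*) [CommRing R] [Fintype R] [DecidableEq R] :
    Fintype (heisenberg R) :=
  Fintype.ofFinite _

/-!
Let `G` be a group of order `p ^ n` and exponent `p`, where `p` is odd, and let `C` be a central
subgroup of order `p`. In blocks indexed by `W = G / C` the group matrix of `F` becomes a `W × W`
matrix over `ℤ[C]`, and the determinant of `F` is the group determinant over `C` of its determinant.
Conjugation by translations of `W` permutes the Leibniz terms of the latter without changing them,
and the term of a permutation commuting with the translations by a subgroup `K` is a `|K|`-th power.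
For `D` in `ℤ[C]` the power `D ^ p ^ k` is congruent to its augmentation modulo `p ^ k`, so the
determinant over `ℤ[C]` is congruent to its augmentation modulo `|W|`. Induction on `n` then yields
`groupDet F ≡ augmentation G F ^ p ^ n` modulo `p ^ n`. So a determinant smaller than `p ^ n` in
absolute value is `0` or satisfies `x ^ (p - 1) ≡ 1` modulo `p ^ n`.

Conversely, an element that is invertible modulo the norm element `∑ g` has determinant equal, up to
sign, to its augmentation, and such elements can be lifted along the central extension. Each lift
needs a congruence with the augmentation modulo `p`. Taking the `p`-th power provides it, while
`x ^ p ≡ x` allows the augmentation to be reset to `x` by a multiple of the norm element.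
-/

open MonoidAlgebra

section Augmentation

variable {G H : Type*} [Monoid G] [Monoid H]

/-- The augmentation `∑ a_g g ↦ ∑ a_g` of the integral group ring. -/
noncomputable def augmentation (G : Type*) [Monoid G] : ℤ[G] →ₐ[ℤ] ℤ :=
  MonoidAlgebra.lift ℤ ℤ G 1

@[simp]
lemma augmentation_single (g : G) (a : ℤ) : augmentation G (single g a) = a := by
  simp [augmentation]

lemma augmentation_eq_sum_coeff [Fintype G] (F : ℤ[G]) : augmentation G F = ∑ g, F.coeff g := by
  simp [augmentation, lift_apply, Finsupp.sum_fintype]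

lemma augmentation_mapDomain (f : G →* H) (F : ℤ[G]) :
    augmentation H (mapDomainRingHom ℤ f F) = augmentation G F := by
  induction F using MonoidAlgebra.induction_linear with
  | zero => simp
  | add F₁ F₂ h₁ h₂ => simp only [map_add, h₁, h₂]
  | single g a => simp

end Augmentation

section GroupDet

variable {G : Type*} [Group G] [Fintype G]

lemma coeff_mul_mul_inv (E F : ℤ[G]) (g h : G) :
    (E * F).coeff (g * h⁻¹) = ∑ k, E.coeff (g * k⁻¹) * F.coeff (k * h⁻¹) := by
  rw [coeff_mul_apply_left, Finsupp.sum_fintype _ _ (by simp)]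
  refine Fintype.sum_equiv ((Equiv.inv G).trans (Equiv.mulRight g)) _ _ fun k => ?_
  simp [mul_assoc]

variable [DecidableEq G]

/-- The regular representation of `ℤ[G]` by matrices indexed by `G`; its determinant is
`groupDet`. -/
noncomputable def regularMatrix : ℤ[G] →+* Matrix G G ℤ where
  toFun F := Matrix.of fun g h => F.coeff (g * h⁻¹)
  map_one' := by
    ext g h
    simp [one_def, Finsupp.single_apply, Matrix.one_apply, eq_comm (a := (1 : G)),
      mul_inv_eq_one]
  map_mul' E F := by
    ext g h
    simp [Matrix.mul_apply, coeff_mul_mul_inv]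
  map_zero' := by ext; simp
  map_add' E F := by ext; simp

lemma regularMatrix_apply (F : ℤ[G]) (g h : G) : regularMatrix F g h = F.coeff (g * h⁻¹) := rfl

lemma groupDet_eq_det_regularMatrix (F : ℤ[G]) : groupDet F = (regularMatrix F).det := rfl

lemma groupDet_mul (E F : ℤ[G]) : groupDet (E * F) = groupDet E * groupDet F := by
  simp only [groupDet_eq_det_regularMatrix, map_mul, Matrix.det_mul]

lemma groupDet_pow (F : ℤ[G]) (k : ℕ) : groupDet (F ^ k) = groupDet F ^ k := by
  simp only [groupDet_eq_det_regularMatrix, map_pow, Matrix.det_pow]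

lemma groupDet_intCast (a : ℤ) : groupDet (a : ℤ[G]) = a ^ Fintype.card G := by
  rw [groupDet_eq_det_regularMatrix, map_intCast]
  simp [← Matrix.diagonal_intCast, Matrix.det_diagonal]

lemma augmentation_dvd_groupDet (F : ℤ[G]) : augmentation G F ∣ groupDet F := by
  have hones : (regularMatrix F).mulVec (fun _ => 1) = fun _ => augmentation G F := by
    ext g
    simp only [Matrix.mulVec, dotProduct, regularMatrix_apply, mul_one, augmentation_eq_sum_coeff]
    exact Fintype.sum_equiv ((Equiv.inv G).trans (Equiv.mulLeft g)) _ _ fun _ => rfl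
  have h := congrFun (congrArg (regularMatrix F).adjugate.mulVec hones) 1
  rw [Matrix.mulVec_mulVec, Matrix.adjugate_mul, Matrix.smul_mulVec, Matrix.one_mulVec] at h
  rw [groupDet_eq_det_regularMatrix]
  simp only [Matrix.mulVec, dotProduct, ← Finset.sum_mul, Pi.smul_apply, smul_eq_mul, mul_one] at h
  exact ⟨_, h.trans (mul_comm _ _)⟩

end GroupDet

section Orbits

lemma card_dvd_sum_of_card_stabilizer_dvd {Γ Ω R : Type*} [Group Γ] [Finite Γ] [MulAction Γ Ω]
    [Fintype Ω] [CommSemiring R] (f : Ω → R) (hf : ∀ (γ : Γ) ω, f (γ • ω) = f ω)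
    (hdvd : ∀ ω, (Nat.card (MulAction.stabilizer Γ ω) : R) ∣ f ω) :
    (Nat.card Γ : R) ∣ ∑ ω, f ω := by
  classical
  have := Fintype.ofFinite Γ
  rw [← (MulAction.selfEquivSigmaOrbits Γ Ω).symm.sum_comp, Fintype.sum_sigma]
  refine Finset.dvd_sum fun q _ => ?_
  have hconst : ∀ x : MulAction.orbit Γ q.out, f x = f q.out := by
    rintro ⟨_, γ, rfl⟩
    exact hf γ _
  have hcard := MulAction.card_orbit_mul_card_stabilizer_eq_card_group Γ q.out
  calc (Nat.card Γ : R)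
      = Fintype.card (MulAction.orbit Γ q.out) * Nat.card (MulAction.stabilizer Γ q.out) := by
        rw [Nat.card_eq_fintype_card, ← hcard, Nat.cast_mul, Nat.card_eq_fintype_card]
    _ ∣ Fintype.card (MulAction.orbit Γ q.out) * f q.out := mul_dvd_mul_left _ (hdvd _)
    _ = ∑ x : MulAction.orbit Γ q.out, f x := by simp [hconst]

variable {K M : Type*} [Group K] [Fintype K] [CommMonoid M]

lemma prod_eq_prod_quotient_prod_subgroup (H : Subgroup K) [Fintype H] [Fintype (K ⧸ H)]
    (f : K → M) : ∏ k, f k = ∏ q : K ⧸ H, ∏ h : H, f (q.out * h) := by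
  rw [← Fintype.prod_prod_type']
  refine (Function.Bijective.prod_comp (e := fun x : (K ⧸ H) × H => x.1.out * x.2) ⟨?_, ?_⟩ f).symm
  · rintro ⟨q, h⟩ ⟨q', h'⟩ heq
    have hq : q = q' := by
      simpa using congrArg (QuotientGroup.mk : K → K ⧸ H) heq
    subst hq
    simpa using heq
  · intro k
    exact ⟨(k, ⟨(k : K ⧸ H).out⁻¹ * k, QuotientGroup.eq.mp (Quotient.out_eq _)⟩), by simp⟩

lemma prod_eq_prod_quotient_prod_range_orderOf (l : K) [Fintype (K ⧸ Subgroup.zpowers l)]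
    (f : K → M) :
    ∏ k, f k = ∏ q : K ⧸ Subgroup.zpowers l, ∏ i ∈ Finset.range (orderOf l),
      f (l ^ i * q.out⁻¹) := by
  classical
  have := Fintype.ofFinite (Subgroup.zpowers l)
  rw [← Equiv.prod_comp (Equiv.inv K), prod_eq_prod_quotient_prod_subgroup (Subgroup.zpowers l)]
  refine Finset.prod_congr rfl fun q _ => ?_
  rw [← Fin.prod_univ_eq_prod_range (fun i => f (l ^ i * q.out⁻¹)),
    ← Equiv.prod_comp (Equiv.inv (Subgroup.zpowers l))]
  refine (Fintype.prod_equiv (finEquivZPowers (isOfFinOrder_of_finite l)) _ _ fun i => ?_).symm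
  simp [finEquivZPowers_apply]

end Orbits

section Matrix

open Matrix

variable {m : Type*} [Fintype m] [DecidableEq m]

lemma det_modEq_of_forall_modEq {r : ℤ} {A B : Matrix m m ℤ}
    (h : ∀ i j, A i j ≡ B i j [ZMOD r]) : A.det ≡ B.det [ZMOD r] := by
  simp only [det_apply']
  exact Int.ModEq.sum fun σ _ => (Int.ModEq.refl _).mul (Int.ModEq.prod fun i _ => h _ _)

lemma sq_dvd_det_sub_prod_diag {R : Type*} [CommRing R] {r : R} {A : Matrix m m R}
    (h : ∀ i j, i ≠ j → r ∣ A i j) : r ^ 2 ∣ A.det - ∏ i, A i i := by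
  have hid : ∏ i, A i i = ((Equiv.Perm.sign (1 : Equiv.Perm m) : ℤ) : R) *
      ∏ i, A ((1 : Equiv.Perm m) i) i := by simp
  rw [det_apply', ← Finset.sum_erase_add _ _ (Finset.mem_univ 1), hid, add_sub_cancel_right]
  refine Finset.dvd_sum fun σ hσ => Dvd.dvd.mul_left ?_ _
  have hsupp := Equiv.Perm.one_lt_card_support_of_ne_one (Finset.ne_of_mem_erase hσ)
  calc r ^ 2 ∣ ∏ _i ∈ σ.support, r := by simpa using pow_dvd_pow r hsupp
    _ ∣ ∏ i ∈ σ.support, A (σ i) i :=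
      Finset.prod_dvd_prod_of_dvd _ _ fun i hi => h _ _ (Equiv.Perm.mem_support.mp hi)
    _ ∣ ∏ i, A (σ i) i := Finset.prod_dvd_prod_of_subset _ _ _ (Finset.subset_univ _)

end Matrix

section Frobenius

variable {M : Type*} [CommMonoid M] {p : ℕ} [hp : Fact p.Prime]

lemma prime_dvd_pow_sub_augmentation (hM : ∀ c : M, c ^ p = 1) (F : ℤ[M]) :
    (p : ℤ[M]) ∣ F ^ p - (augmentation M F : ℤ[M]) := by
  induction F using MonoidAlgebra.induction_linear with
  | zero => simp [hp.out.ne_zero]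
  | add E F hE hF =>
    obtain ⟨r, hr⟩ := exists_add_pow_prime_eq hp.out E F
    have h := dvd_add (dvd_add hE hF) (dvd_mul_right (p : ℤ[M]) (E * F * r))
    convert h using 1
    rw [hr, map_add, Int.cast_add]
    ring
  | single c a =>
    obtain ⟨t, ht⟩ : (p : ℤ) ∣ a ^ p - a :=
      (Int.modEq_iff_dvd.mp (ZMod.intCast_eq_intCast_iff a (a ^ p) p |>.mp (by simp)))
    refine ⟨t, ?_⟩
    rw [single_pow, hM, augmentation_single, intCast_def, intCast_def, natCast_def,
      single_mul_single, ← single_sub]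
    simp [ht]

lemma prime_pow_dvd_pow_sub_augmentation (hM : ∀ c : M, c ^ p = 1) (F : ℤ[M]) (k : ℕ) :
    ((p ^ k : ℕ) : ℤ[M]) ∣ F ^ p ^ k - (augmentation M (F ^ p ^ k) : ℤ[M]) := by
  cases k with
  | zero => simp
  | succ k =>
    have haug : (p : ℤ[M]) ∣ (augmentation M F : ℤ[M]) ^ p - (augmentation M F : ℤ[M]) := by
      simpa using prime_dvd_pow_sub_augmentation hM (augmentation M F : ℤ[M])
    have h : (p : ℤ[M]) ∣ F ^ p - (augmentation M F : ℤ[M]) ^ p := by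
      simpa using dvd_sub (prime_dvd_pow_sub_augmentation hM F) haug
    simpa [pow_succ', pow_mul] using dvd_sub_pow_of_dvd_sub h k

end Frobenius

section CosetSlice

variable {C G W : Type*} [Group C] [Fintype C] [Group G] [Group W] (S : GroupExtension C G W)

omit [Fintype C] in
lemma exists_mul_inl_eq_of_rightHom_eq {g h : G} (hgh : S.rightHom g = S.rightHom h) :
    ∃ c, g * S.inl c = h := by
  have hker : g⁻¹ * h ∈ S.inl.range := by
    rw [S.range_inl_eq_ker_rightHom, MonoidHom.mem_ker]
    simp [hgh]
  obtain ⟨c, hc⟩ := hker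
  exact ⟨c, by simp [hc]⟩

/-- The coefficients of `F` on the coset `g C` of the kernel `C`, as the element
`∑ a_{g c} c` of `ℤ[C]`. -/
noncomputable def cosetSlice (F : ℤ[G]) (g : G) : ℤ[C] :=
  ∑ c, single c (F.coeff (g * S.inl c))

@[simp]
lemma coeff_cosetSlice (F : ℤ[G]) (g : G) (c : C) :
    (cosetSlice S F g).coeff c = F.coeff (g * S.inl c) := by
  classical
  simp [cosetSlice, Finsupp.single_apply]

lemma cosetSlice_mul_inl (F : ℤ[G]) (g : G) (z : C) :
    cosetSlice S F (g * S.inl z) = of ℤ C z⁻¹ * cosetSlice S F g := by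
  ext c
  simp [of_apply, coeff_single_mul_apply, mul_assoc]

lemma augmentation_cosetSlice (F : ℤ[G]) (g : G) :
    augmentation C (cosetSlice S F g)
      = (mapDomainRingHom ℤ S.rightHom F).coeff (S.rightHom g) := by
  classical
  simp only [augmentation_eq_sum_coeff, coeff_cosetSlice]
  induction F using MonoidAlgebra.induction_linear with
  | zero => simp
  | add E F hE hF =>
    simp only [map_add, coeff_add, Finsupp.add_apply, Finset.sum_add_distrib, hE, hF]
  | single h a =>
    by_cases hgh : S.rightHom g = S.rightHom h
    · obtain ⟨c, rfl⟩ := exists_mul_inl_eq_of_rightHom_eq S hgh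
      simp [Finsupp.single_apply, S.inl_injective.eq_iff]
    · have hne : ∀ c, h ≠ g * S.inl c := by
        rintro c rfl
        simp at hgh
      simp [hne, Ne.symm hgh]

variable {S} in
omit [Fintype C] in
lemma section_mul_inl_bijective (s : S.Section) :
    Function.Bijective fun x : W × C => s x.1 * S.inl x.2 := by
  constructor
  · rintro ⟨w, c⟩ ⟨w', c'⟩ h
    have hw : w = w' := by simpa using congrArg S.rightHom h
    subst hw
    simpa [S.inl_injective.eq_iff] using h
  · intro g
    obtain ⟨c, hc⟩ := exists_mul_inl_eq_of_rightHom_eq S (g := s (S.rightHom g)) (h := g) (by simp)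
    exact ⟨(_, c), hc⟩

end CosetSlice

section CentralExtension

variable {C G W : Type*} [CommGroup C] [Fintype C] [Group G] [Group W] (S : GroupExtension C G W)

/-- The matrix over `ℤ[C]` whose entries carry the `C × C` blocks of the regular matrix of `F`, the
cosets of `C` being labelled by the section `s`. -/
noncomputable def sectionMatrix (s : S.Section) (F : ℤ[G]) : Matrix W W ℤ[C] :=
  Matrix.of fun x y => cosetSlice S F (s x * (s y)⁻¹)

variable {S} (hcentral : ∀ c, S.inl c ∈ Subgroup.center G)
include hcentral

lemma groupDet_eq_groupDet_det_sectionMatrix [Fintype G] [DecidableEq G] [Fintype W]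
    [DecidableEq W] [DecidableEq C] (s : S.Section) (F : ℤ[G]) :
    groupDet F = groupDet (sectionMatrix S s F).det := by
  have hblock : Matrix.comp W W C C ℤ ((sectionMatrix S s F).map regularMatrix)
      = (regularMatrix F).submatrix (fun x : W × C => s x.1 * S.inl x.2)
          (fun x => s x.1 * S.inl x.2) := by
    ext ⟨x, c⟩ ⟨y, d⟩
    have hcomm := Subgroup.mem_center_iff.mp (hcentral (c * d⁻¹)) (s y)⁻¹
    simp only [map_mul, map_inv] at hcomm
    simp [Matrix.comp_apply, regularMatrix_apply, sectionMatrix, mul_assoc, hcomm]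
  rw [groupDet_eq_det_regularMatrix (sectionMatrix S s F).det, Matrix.det_det, hblock,
    groupDet_eq_det_regularMatrix]
  exact (Matrix.det_submatrix_equiv_self (Equiv.ofBijective _ (section_mul_inl_bijective s)) _).symm

omit hcentral in
lemma augmentation_det_sectionMatrix [Fintype W] [DecidableEq W] (s : S.Section) (F : ℤ[G]) :
    augmentation C (sectionMatrix S s F).det = groupDet (mapDomainRingHom ℤ S.rightHom F) := by
  rw [AlgHom.map_det, groupDet_eq_det_regularMatrix]
  congr 1
  ext x y
  simp [sectionMatrix, augmentation_cosetSlice, regularMatrix_apply]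

/-- The term of `σ` in the Leibniz expansion of the determinant of `sectionMatrix S s F`, without
its sign. -/
noncomputable def leibnizProd [Fintype W] (s : S.Section) (F : ℤ[G]) (σ : Equiv.Perm W) : ℤ[C] :=
  ∏ y, sectionMatrix S s F (σ y) y

lemma leibnizProd_eq_leibnizProd [Fintype W] (s s' : S.Section) (F : ℤ[G]) (σ : Equiv.Perm W) :
    leibnizProd s' F σ = leibnizProd s F σ := by
  choose c hc using fun w => s'.exists_eq_mul_inl s w
  have hentry : ∀ x y, sectionMatrix S s' F x y
      = of ℤ C ((c x)⁻¹ * c y) * sectionMatrix S s F x y := by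
    intro x y
    have hcomm := Subgroup.mem_center_iff.mp (hcentral (c x * (c y)⁻¹)) (s y)⁻¹
    have hxy : s' x * (s' y)⁻¹ = s x * (s y)⁻¹ * S.inl (c x * (c y)⁻¹) := by
      rw [mul_assoc, hcomm, hc, hc]
      simp [mul_assoc]
    simp only [sectionMatrix, Matrix.of_apply, hxy, cosetSlice_mul_inl, mul_inv, inv_inv]
  have hprod : ∏ y, ((c (σ y))⁻¹ * c y) = 1 := by
    rw [Finset.prod_mul_distrib, Finset.prod_inv_distrib, Equiv.prod_comp σ c, inv_mul_cancel]
  simp only [leibnizProd, hentry, Finset.prod_mul_distrib, ← map_prod, hprod, map_one, one_mul]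

omit hcentral [Fintype C] in
lemma prod_range_defect (s : S.Section) (l k : W) (c : W → C)
    (hc : ∀ w, s (l * w) = s l * s w * S.inl (c w)) (d : ℕ) :
    s (l ^ d * k) = s l ^ d * s k * S.inl (∏ i ∈ Finset.range d, c (l ^ i * k)) := by
  induction d with
  | zero => simp
  | succ d ih =>
    rw [pow_succ' l, mul_assoc, hc, ih, Finset.prod_range_succ]
    simp [pow_succ', mul_assoc]

omit hcentral [Fintype C] in
lemma prod_defect_eq_one (s : S.Section) (K : Subgroup W) [Fintype K] (l : K)
    (hl : s l ^ orderOf l = 1) (c : W → C)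
    (hc : ∀ w, s (l * w) = s l * s w * S.inl (c w)) : ∏ k : K, c k = 1 := by
  classical
  have := Fintype.ofFinite (K ⧸ Subgroup.zpowers l)
  rw [prod_eq_prod_quotient_prod_range_orderOf l]
  refine Finset.prod_eq_one fun q _ => S.inl_injective ?_
  have h := prod_range_defect s (l : W) (q.out⁻¹ : K) c hc (orderOf l)
  have hlW : (l : W) ^ orderOf l = 1 := by simp [← Subgroup.coe_pow, pow_orderOf_eq_one]
  simpa [hl, hlW] using h

omit hcentral [Fintype C] in
lemma exists_section_pow_orderOf_eq_one {p : ℕ} [hp : Fact p.Prime] (hG : ∀ g : G, g ^ p = 1) :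
    ∃ s : S.Section, ∀ w, s w ^ orderOf w = 1 := by
  have hlift : ∀ w, ∃ g, S.rightHom g = w ∧ g ^ orderOf w = 1 := by
    intro w
    by_cases hw : w = 1
    · exact ⟨1, by simp [hw]⟩
    · obtain ⟨g, rfl⟩ := S.rightHom_surjective w
      have horder : orderOf (S.rightHom g) = p :=
        orderOf_eq_prime (by rw [← map_pow, hG, map_one]) hw
      exact ⟨g, rfl, by rw [horder, hG]⟩
  choose s hs hpow using hlift
  exact ⟨⟨s, hs⟩, hpow⟩

/-- The section `q.out * k ↦ s q.out * s k`, which is multiplicative between the chosen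
representatives of `W ⧸ K` and the subgroup `K`. -/
noncomputable def cosetSection (s : S.Section) (K : Subgroup W) : S.Section where
  toFun w := s (w : W ⧸ K).out * s ((w : W ⧸ K).out⁻¹ * w)
  rightInverse_rightHom w := by simp

omit hcentral [Fintype C] in
lemma cosetSection_out_mul (s : S.Section) {K : Subgroup W} (q : W ⧸ K) {k : W} (hk : k ∈ K) :
    cosetSection s K (q.out * k) = s q.out * s k := by
  have hq : ((q.out * k : W) : W ⧸ K) = q := by simp [hk]
  change s _ * s _ = _
  rw [hq, inv_mul_cancel_left]

lemma prod_sectionMatrix_cosetSection (s : S.Section) (hs : ∀ w, s w ^ orderOf w = 1)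
    (F : ℤ[G]) {K : Subgroup W} [Fintype K] (q q' : W ⧸ K) (l : K) :
    ∏ k : K, sectionMatrix S (cosetSection s K) F (q'.out * l * k) (q.out * k)
      = cosetSlice S F (s q'.out * s l * (s q.out)⁻¹) ^ Nat.card K := by
  choose c hc using fun w => s.exists_mul_eq_mul_mul_inl l w
  have hentry : ∀ k : K, sectionMatrix S (cosetSection s K) F (q'.out * l * k) (q.out * k)
      = of ℤ C (c k)⁻¹ * cosetSlice S F (s q'.out * s l * (s q.out)⁻¹) := by
    intro k
    have hcomm := Subgroup.mem_center_iff.mp (hcentral (c k)) ((s k)⁻¹ * (s q.out)⁻¹)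
    rw [sectionMatrix, Matrix.of_apply, mul_assoc, cosetSection_out_mul s _ (K.mul_mem l.2 k.2),
      cosetSection_out_mul s _ k.2, hc, ← cosetSlice_mul_inl]
    congr 1
    simp only [mul_inv_rev, mul_assoc, ← hcomm, mul_inv_cancel_left]
  have hprod : ∏ k : K, (c k)⁻¹ = 1 := by
    rw [Finset.prod_inv_distrib, prod_defect_eq_one s K l (by simpa using hs l) c hc, inv_one]
  simp only [hentry, Finset.prod_mul_distrib, ← map_prod, hprod, map_one, one_mul]
  simp

lemma exists_leibnizProd_eq_pow [Fintype W] (s : S.Section) (hs : ∀ w, s w ^ orderOf w = 1)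
    (F : ℤ[G]) {σ : Equiv.Perm W} (K : Subgroup W) (hσ : ∀ y, ∀ k ∈ K, σ (y * k) = σ y * k) :
    ∃ m, leibnizProd s F σ = m ^ Nat.card K := by
  classical
  have := Fintype.ofFinite K
  have := Fintype.ofFinite (W ⧸ K)
  have hrep : ∀ q : W ⧸ K, ∃ l : K, σ q.out = (σ q.out : W ⧸ K).out * l := fun q =>
    ⟨⟨_, QuotientGroup.eq.mp (Quotient.out_eq (σ q.out : W ⧸ K))⟩, by simp⟩
  choose l hl using hrep
  refine ⟨∏ q : W ⧸ K, cosetSlice S F (s (σ q.out : W ⧸ K).out * s (l q) * (s q.out)⁻¹), ?_⟩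
  rw [← leibnizProd_eq_leibnizProd hcentral s (cosetSection s K), leibnizProd,
    prod_eq_prod_quotient_prod_subgroup K, ← Finset.prod_pow]
  refine Finset.prod_congr rfl fun q _ => ?_
  rw [← prod_sectionMatrix_cosetSection hcentral s hs]
  exact Finset.prod_congr rfl fun k _ => by rw [← hl, hσ _ _ k.2]

/-- Right translations as permutations of `W`, made into a homomorphism by inverting. -/
def rightTranslation (W : Type*) [Group W] : W →* Equiv.Perm W where
  toFun k := Equiv.mulRight k⁻¹
  map_one' := by ext; simp
  map_mul' k l := by ext; simp [mul_assoc]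

lemma leibnizProd_conj_rightTranslation [Fintype W] (s : S.Section) (F : ℤ[G]) (k : W)
    (σ : Equiv.Perm W) :
    leibnizProd s F (rightTranslation W k * σ * (rightTranslation W k)⁻¹) = leibnizProd s F σ := by
  obtain ⟨g, hg⟩ := S.rightHom_surjective k
  let s' : S.Section := ⟨fun w => s (w * k) * g⁻¹, fun w => by simp [hg]⟩
  rw [← leibnizProd_eq_leibnizProd hcentral s s']
  refine Fintype.prod_equiv (Equiv.mulRight k) _ _ fun y => congrArg (cosetSlice S F) ?_
  simp [s', rightTranslation]

lemma card_dvd_leibnizProd_sub_augmentation {p : ℕ} [Fact p.Prime] [Fintype W]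
    (hC : ∀ c : C, c ^ p = 1) (hW : IsPGroup p W)
    (s : S.Section) (hs : ∀ w, s w ^ orderOf w = 1)
    (F : ℤ[G]) {σ : Equiv.Perm W} (K : Subgroup W) (hσ : ∀ y, ∀ k ∈ K, σ (y * k) = σ y * k) :
    (Nat.card K : ℤ[C]) ∣ leibnizProd s F σ - (augmentation C (leibnizProd s F σ) : ℤ[C]) := by
  obtain ⟨m, hm⟩ := exists_leibnizProd_eq_pow hcentral s hs F K hσ
  obtain ⟨k, hk⟩ := IsPGroup.iff_card.mp (hW.to_subgroup K)
  rw [hm, hk]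
  exact prime_pow_dvd_pow_sub_augmentation hC m k

lemma card_dvd_det_sectionMatrix_sub_augmentation {p : ℕ} [Fact p.Prime] [Fintype W]
    [DecidableEq W] (hC : ∀ c : C, c ^ p = 1) (hW : IsPGroup p W) (s : S.Section)
    (hs : ∀ w, s w ^ orderOf w = 1) (F : ℤ[G]) :
    (Nat.card W : ℤ[C]) ∣ (sectionMatrix S s F).det
      - (augmentation C (sectionMatrix S s F).det : ℤ[C]) := by
  let _ : MulAction W (Equiv.Perm W) :=
    MulAction.compHom _ (MulAut.conj.comp (rightTranslation W))
  have hsmul : ∀ (k : W) (σ : Equiv.Perm W),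
      k • σ = rightTranslation W k * σ * (rightTranslation W k)⁻¹ := fun _ _ => rfl
  have hsum : (sectionMatrix S s F).det - (augmentation C (sectionMatrix S s F).det : ℤ[C])
      = ∑ σ : Equiv.Perm W, ((Equiv.Perm.sign σ : ℤ) : ℤ[C]) *
        (leibnizProd s F σ - (augmentation C (leibnizProd s F σ) : ℤ[C])) := by
    simp [Matrix.det_apply', leibnizProd, mul_sub]
  rw [hsum]
  refine card_dvd_sum_of_card_stabilizer_dvd _ (fun k σ => ?_) fun σ => Dvd.dvd.mul_left ?_ _
  · rw [hsmul, leibnizProd_conj_rightTranslation hcentral, map_mul, map_mul, map_inv,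
      mul_inv_cancel_comm]
  · refine card_dvd_leibnizProd_sub_augmentation hcentral hC hW s hs F _ fun y k hk => ?_
    have h : k • σ = σ := hk
    rw [← mul_inv_eq_iff_eq_mul]
    simpa [hsmul, rightTranslation] using Equiv.congr_fun h y

end CentralExtension

section Congruence

lemma groupDet_eq_augmentation_of_card_eq_one {G : Type*} [Group G] [Fintype G] [DecidableEq G]
    (hG : Nat.card G = 1) (F : ℤ[G]) : groupDet F = augmentation G F := by
  have := (Nat.card_eq_one_iff_unique.mp hG).1
  rw [groupDet_eq_det_regularMatrix, Matrix.det_eq_elem_of_subsingleton _ 1, regularMatrix_apply,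
    augmentation_eq_sum_coeff, Fintype.sum_subsingleton _ 1, inv_one, mul_one]

lemma coeff_modEq_of_dvd_sub {G : Type*} [Group G] {r : ℤ} {E F : ℤ[G]}
    (h : (r : ℤ[G]) ∣ E - F) (g : G) : E.coeff g ≡ F.coeff g [ZMOD r] := by
  obtain ⟨D, hD⟩ := h
  refine (Int.modEq_iff_dvd.mpr ⟨D.coeff g, ?_⟩).symm
  rw [← Finsupp.sub_apply, ← coeff_sub, hD, intCast_def, coeff_single_mul_apply]
  simp

lemma groupDet_modEq_of_dvd_sub {G : Type*} [Group G] [Fintype G] [DecidableEq G] {r : ℤ}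
    {E F : ℤ[G]} (h : (r : ℤ[G]) ∣ E - F) : groupDet E ≡ groupDet F [ZMOD r] :=
  det_modEq_of_forall_modEq fun _ _ => coeff_modEq_of_dvd_sub h _

variable {p : ℕ} [hp : Fact p.Prime]

omit hp in
lemma pow_prime_modEq_pow_prime {a b : ℤ} {j : ℕ} (hj : j ≠ 0) (h : a ≡ b [ZMOD (p ^ j : ℕ)]) :
    a ^ p ≡ b ^ p [ZMOD (p ^ (j + 1) : ℕ)] := by
  have hdvd := h.symm.dvd
  have hp_dvd : (p : ℤ) ∣ a - b :=
    (Int.natCast_dvd_natCast.mpr (dvd_pow_self p hj)).trans hdvd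
  refine (Int.modEq_iff_dvd.mpr ?_).symm
  rw [← (Commute.all a b).mul_geom_sum₂, pow_succ, Nat.cast_mul]
  exact mul_dvd_mul hdvd (dvd_geom_sum₂_self hp_dvd)

variable {C : Type*} [CommGroup C] [Fintype C] [DecidableEq C]

lemma groupDet_modEq_augmentation_pow_card (hC : ∀ c : C, c ^ p = 1) (D : ℤ[C]) :
    groupDet D ≡ augmentation C D ^ Fintype.card C [ZMOD p] := by
  calc groupDet D ≡ groupDet D ^ p [ZMOD p] := by
        rw [← ZMod.intCast_eq_intCast_iff]; simp
    _ = groupDet (D ^ p) := (groupDet_pow D p).symm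
    _ ≡ groupDet (augmentation C D : ℤ[C]) [ZMOD p] :=
        groupDet_modEq_of_dvd_sub (by exact_mod_cast prime_dvd_pow_sub_augmentation hC D)
    _ = augmentation C D ^ Fintype.card C := groupDet_intCast _

omit hp in
lemma groupDet_modEq_pow_of_dvd_sub (hcard : Fintype.card C = p) {j : ℕ} (hj : j ≠ 0) {D : ℤ[C]}
    {a : ℤ} (hD : ((p ^ j : ℕ) : ℤ[C]) ∣ D - a) :
    groupDet D ≡ a ^ p [ZMOD (p ^ (j + 1) : ℕ)] := by
  have hcoeff : ∀ c, D.coeff c ≡ (a : ℤ[C]).coeff c [ZMOD (p ^ j : ℕ)] :=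
    coeff_modEq_of_dvd_sub (by exact_mod_cast hD)
  have hoff : ∀ c d : C, c ≠ d → ((p ^ j : ℕ) : ℤ) ∣ regularMatrix D c d := by
    intro c d hcd
    have h := hcoeff (c * d⁻¹)
    rw [intCast_def, coeff_single, Finsupp.single_eq_of_ne (by rwa [ne_eq, mul_inv_eq_one])] at h
    exact Int.modEq_zero_iff_dvd.mp h
  have hdiag : ∏ c, regularMatrix D c c = D.coeff 1 ^ p := by
    simp [regularMatrix_apply, hcard]
  have hle : ((p ^ (j + 1) : ℕ) : ℤ) ∣ ((p ^ j : ℕ) : ℤ) ^ 2 := by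
    rw [← Nat.cast_pow, ← pow_mul]
    exact Int.natCast_dvd_natCast.mpr (pow_dvd_pow p (by omega))
  calc groupDet D ≡ D.coeff 1 ^ p [ZMOD (p ^ (j + 1) : ℕ)] :=
        (Int.modEq_iff_dvd.mpr (hle.trans (hdiag ▸ sq_dvd_det_sub_prod_diag hoff))).symm
    _ ≡ a ^ p [ZMOD (p ^ (j + 1) : ℕ)] :=
        pow_prime_modEq_pow_prime hj (by simpa [intCast_def] using hcoeff 1)

end Congruence

section Induction

universe u

open scoped IsMulCommutative in
lemma exists_central_extension {p n : ℕ} [hp : Fact p.Prime] {G : Type u} [Group G]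
    (hcard : Nat.card G = p ^ (n + 1)) :
    ∃ (C W : Type u) (_ : CommGroup C) (_ : Group W) (S : GroupExtension C G W),
      Nat.card C = p ∧ Nat.card W = p ^ n ∧ ∀ c, S.inl c ∈ Subgroup.center G := by
  have : Finite G := Nat.finite_of_card_ne_zero (by simp [hcard, hp.out.ne_zero])
  obtain ⟨k, hk, hcenter⟩ := IsPGroup.card_center_eq_prime_pow hcard n.succ_pos
  obtain ⟨⟨z, hz⟩, hzp⟩ := exists_prime_orderOf_dvd_card' p (hcenter ▸ dvd_pow_self p hk.ne')
  rw [Subgroup.orderOf_mk] at hzp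
  have hle : Subgroup.zpowers z ≤ Subgroup.center G := by simpa using hz
  have : (Subgroup.zpowers z).Normal :=
    ⟨fun c hc g => by rwa [Subgroup.mem_center_iff.mp (hle hc) g, mul_inv_cancel_right]⟩
  have hC : Nat.card (Subgroup.zpowers z) = p := by rw [Nat.card_zpowers, hzp]
  refine ⟨Subgroup.zpowers z, G ⧸ Subgroup.zpowers z, inferInstance, inferInstance,
    ⟨(Subgroup.zpowers z).subtype, QuotientGroup.mk' _, Subtype.val_injective, by simp,
      QuotientGroup.mk'_surjective _⟩, hC, ?_, fun c => hle c.2⟩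
  have h := Subgroup.card_eq_card_quotient_mul_card_subgroup (Subgroup.zpowers z)
  rw [hcard, hC, pow_succ] at h
  exact (Nat.eq_of_mul_eq_mul_right hp.out.pos h).symm

theorem groupDet_modEq_augmentation_pow {p n : ℕ} [hp : Fact p.Prime] {G : Type u} [Group G]
    [Fintype G] [DecidableEq G] (hG : ∀ g : G, g ^ p = 1) (hcard : Nat.card G = p ^ n)
    (F : ℤ[G]) : groupDet F ≡ augmentation G F ^ p ^ n [ZMOD (p ^ n : ℕ)] := by
  classical
  induction n generalizing G with
  | zero => simp [Int.modEq_one]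
  | succ n ih =>
    obtain ⟨C, W, _, _, S, hCcard, hWcard, hcentral⟩ := exists_central_extension hcard
    have := Fintype.ofInjective S.inl S.inl_injective
    have := Fintype.ofSurjective S.rightHom S.rightHom_surjective
    have hC : ∀ c : C, c ^ p = 1 := fun c => S.inl_injective (by rw [map_pow, hG, map_one])
    have hW : ∀ w : W, w ^ p = 1 := S.rightHom_surjective.forall.mpr fun g => by
      rw [← map_pow, hG, map_one]
    obtain ⟨s, hs⟩ := exists_section_pow_orderOf_eq_one (S := S) hG
    have hdvd := card_dvd_det_sectionMatrix_sub_augmentation hcentral hC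
      (IsPGroup.of_card hWcard) s hs F
    have ihW := ih hW hWcard (mapDomainRingHom ℤ S.rightHom F)
    rw [augmentation_mapDomain] at ihW
    rw [groupDet_eq_groupDet_det_sectionMatrix hcentral s F]
    rw [hWcard, augmentation_det_sectionMatrix] at hdvd
    rw [Nat.card_eq_fintype_card] at hCcard
    rcases eq_or_ne n 0 with rfl | hn
    · have h := groupDet_modEq_augmentation_pow_card hC (sectionMatrix S s F).det
      rw [augmentation_det_sectionMatrix, groupDet_eq_augmentation_of_card_eq_one hWcard,
        augmentation_mapDomain, hCcard] at h
      simpa using h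
    · rw [pow_succ, pow_mul]
      exact (groupDet_modEq_pow_of_dvd_sub hCcard hn hdvd).trans (pow_prime_modEq_pow_prime hn ihW)

end Induction

lemma pow_dvd_natAbs_groupDet_or_pow_modEq_one {p n : ℕ} [hp : Fact p.Prime] (hodd : p ≠ 2)
    {G : Type*} [Group G] [Fintype G] [DecidableEq G] (hG : ∀ g : G, g ^ p = 1)
    (hcard : Nat.card G = p ^ n) (F : ℤ[G]) :
    p ^ n ∣ (groupDet F).natAbs ∨ (groupDet F).natAbs ^ (p - 1) ≡ 1 [MOD p ^ n] := by
  have hmod := groupDet_modEq_augmentation_pow hG hcard F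
  by_cases hdvd : p ∣ (augmentation G F).natAbs
  · left
    have hpow : p ^ n ∣ (augmentation G F ^ p ^ n).natAbs := by
      rw [Int.natAbs_pow]
      exact (pow_dvd_pow_of_dvd hdvd n).trans (pow_dvd_pow _ (Nat.lt_pow_self hp.out.one_lt).le)
    exact Int.natCast_dvd.mp (hmod.dvd_iff.mpr (Int.natCast_dvd.mpr hpow))
  · right
    have heven : Even (p - 1) := hp.out.even_sub_one hodd
    have heuler : (augmentation G F).natAbs ^ (p ^ n * (p - 1)) ≡ 1 [MOD p ^ (n + 1)] := by
      rw [← Nat.totient_prime_pow_succ hp.out]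
      exact Nat.ModEq.pow_totient (((hp.out.coprime_iff_not_dvd.mpr hdvd).symm).pow_right _)
    refine Nat.ModEq.trans (b := (augmentation G F).natAbs ^ (p ^ n * (p - 1))) ?_
      (heuler.of_dvd (pow_dvd_pow p n.le_succ))
    rw [← Int.natCast_modEq_iff]
    push_cast
    simpa [heven.pow_abs, (heven.mul_left _).pow_abs, pow_mul] using hmod.pow (p - 1)

section UnitModNorm

/-- The norm element `∑ g` of the group ring. -/
noncomputable def normElement (G : Type*) [Fintype G] : ℤ[G] := ∑ g, single g 1

lemma coeff_normElement {G : Type*} [Fintype G] (g : G) : (normElement G).coeff g = 1 := by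
  classical
  simp [normElement, Finsupp.single_apply]

variable {G : Type*} [Group G] [Fintype G]

lemma augmentation_normElement : augmentation G (normElement G) = Fintype.card G := by
  simp [normElement]

lemma mul_normElement (F : ℤ[G]) : F * normElement G = augmentation G F • normElement G := by
  induction F using MonoidAlgebra.induction_linear with
  | zero => simp
  | add E F hE hF => simp only [add_mul, map_add, add_smul, hE, hF]
  | single g a => ext h; simp [coeff_single_mul_apply, coeff_normElement, -zsmul_eq_mul]

lemma normElement_mul (F : ℤ[G]) : normElement G * F = augmentation G F • normElement G := by
  induction F using MonoidAlgebra.induction_linear with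
  | zero => simp
  | add E F hE hF => simp only [mul_add, map_add, add_smul, hE, hF]
  | single g a => ext h; simp [coeff_mul_single_apply, coeff_normElement, -zsmul_eq_mul]

lemma groupDet_one_add_smul_normElement [DecidableEq G] (k : ℤ) :
    groupDet (1 + k • normElement G) = 1 + k * Fintype.card G := by
  have hN : regularMatrix (k • normElement G)
      = Matrix.replicateCol Unit (fun _ : G => k) *
        Matrix.replicateRow Unit (fun _ => (1 : ℤ)) := by
    ext g h
    simp [regularMatrix_apply, coeff_normElement, Matrix.mul_apply, -zsmul_eq_mul]
  rw [groupDet_eq_det_regularMatrix, map_add, map_one, hN,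
    Matrix.det_one_add_replicateCol_mul_replicateRow]
  simp [dotProduct, mul_comm]

/-- `F` has a right inverse modulo the ideal generated by the norm element, that is, in
`ℤ[G] / (∑ g)`. -/
def IsUnitModNorm (F : ℤ[G]) : Prop :=
  ∃ (F' : ℤ[G]) (k : ℤ), F * F' = 1 + k • normElement G

lemma IsUnitModNorm.mul {E F : ℤ[G]} (hE : IsUnitModNorm E) (hF : IsUnitModNorm F) :
    IsUnitModNorm (E * F) := by
  obtain ⟨E', k, hEE'⟩ := hE
  obtain ⟨F', l, hFF'⟩ := hF
  refine ⟨F' * E', k + l * (augmentation G E * augmentation G E'), ?_⟩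
  calc E * F * (F' * E') = E * (1 + l • normElement G) * E' := by rw [← hFF']; noncomm_ring
    _ = E * E' + l • (E * (normElement G * E')) := by
        simp only [mul_add, add_mul, mul_one, mul_smul_comm, smul_mul_assoc, mul_assoc]
    _ = 1 + (k + l * (augmentation G E * augmentation G E')) • normElement G := by
        rw [hEE', normElement_mul, mul_smul_comm, mul_normElement]
        module

lemma IsUnitModNorm.pow {F : ℤ[G]} (hF : IsUnitModNorm F) (k : ℕ) : IsUnitModNorm (F ^ k) := by
  induction k with
  | zero => exact ⟨1, 0, by simp⟩
  | succ k ih => exact pow_succ F k ▸ ih.mul hF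

lemma IsUnitModNorm.add_smul_normElement {F : ℤ[G]} (hF : IsUnitModNorm F) (l : ℤ) :
    IsUnitModNorm (F + l • normElement G) := by
  obtain ⟨F', k, hFF'⟩ := hF
  refine ⟨F', k + l * augmentation G F', ?_⟩
  rw [add_mul, hFF', smul_mul_assoc, normElement_mul]
  module

lemma exists_mul_eq_one_add_mul_smul_normElement {x y q t : ℤ}
    (hxy : x * y = 1 + t * q) {E : ℤ[G]} (hE : IsUnitModNorm (x • 1 + q • E)) :
    ∃ (E' : ℤ[G]) (k : ℤ),
      (x • 1 + q • E) * (y • 1 + q • E') = 1 + (q * k) • normElement G := by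
  obtain ⟨F', k, hF'⟩ := hE
  have hEF' : q • (E * F') = 1 + k • normElement G - x • F' := by
    rw [← hF', add_mul, smul_mul_assoc, smul_mul_assoc, one_mul]
    abel
  have hcorrect : y • 1 + q • (-(y • (E * F')) - t • F') = F' - (y * k) • normElement G := by
    calc y • 1 + q • (-(y • (E * F')) - t • F')
        = y • 1 - y • (q • (E * F')) - (t * q) • F' := by module
      _ = F' - (y * k) • normElement G := by
        rw [hEF', show t * q = x * y - 1 by linarith]
        module
  refine ⟨-(y • (E * F')) - t • F', -(k * (t + y * augmentation G E)), ?_⟩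
  rw [hcorrect, mul_sub, hF', mul_smul_comm, mul_normElement, map_add, map_zsmul, map_zsmul,
    map_one, smul_eq_mul, smul_eq_mul, mul_one]
  linear_combination (norm := module) (-k * hxy) • normElement G

lemma IsUnitModNorm.natAbs_groupDet [DecidableEq G] [Nontrivial G] {F : ℤ[G]}
    (hF : IsUnitModNorm F) : (groupDet F).natAbs = (augmentation G F).natAbs := by
  obtain ⟨F', k, hFF'⟩ := hF
  have hdet : groupDet F * groupDet F' = 1 + k * Fintype.card G := by
    rw [← groupDet_mul, hFF', groupDet_one_add_smul_normElement]
  have haug : augmentation G F * augmentation G F' = 1 + k * Fintype.card G := by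
    rw [← map_mul, hFF']
    simp [augmentation_normElement]
  have hne : 1 + k * (Fintype.card G : ℤ) ≠ 0 := fun h =>
    (Fintype.one_lt_card (α := G)).ne' (by
      have : (Fintype.card G : ℤ) ∣ 1 := ⟨-k, by linarith⟩
      exact_mod_cast Int.eq_one_of_dvd_one (by positivity) this)
  obtain ⟨r, hr⟩ := augmentation_dvd_groupDet F
  obtain ⟨r', hr'⟩ := augmentation_dvd_groupDet F'
  have hunit : r * r' = 1 := by
    refine mul_left_cancel₀ hne ?_
    linear_combination
      haug.symm * (r * r') + hr * (-groupDet F') - (augmentation G F * r) * hr' + hdet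
  rw [hr, Int.natAbs_mul, Int.isUnit_iff_natAbs_eq.mp (.of_mul_eq_one r' hunit), mul_one]

lemma geom_sum_mul_geom_sum_pow {R : Type*} [CommSemiring R] (r : R) (x y : ℕ) :
    (∑ i ∈ Finset.range x, r ^ i) * ∑ j ∈ Finset.range y, (r ^ x) ^ j
      = ∑ i ∈ Finset.range (x * y), r ^ i := by
  induction y with
  | zero => simp
  | succ y ih =>
    rw [Finset.sum_range_succ, mul_add, ih, Nat.mul_succ, Finset.sum_range_add, Finset.sum_mul]
    simp only [pow_add, pow_mul, mul_comm]

section Cyclic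

variable {C : Type*} [CommGroup C] [Fintype C]

lemma geom_sum_orderOf_eq_normElement {c : C} (hc : ∀ z, z ∈ Subgroup.zpowers c) :
    ∑ i ∈ Finset.range (orderOf c), of ℤ C c ^ i = normElement C := by
  classical
  rw [normElement, ← IsCyclic.image_range_orderOf hc, Finset.sum_image]
  · simp [of_apply]
  · simpa using pow_injOn_Iio_orderOf

lemma exists_isUnitModNorm_of_isCyclic [IsCyclic C] [Nontrivial C] {x : ℕ}
    (hx : x.Coprime (Nat.card C)) :
    ∃ a : ℤ[C], augmentation C a = x ∧ IsUnitModNorm a := by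
  obtain ⟨c, hc⟩ := IsCyclic.exists_generator (α := C)
  have horder : orderOf c = Nat.card C := orderOf_eq_card_of_forall_mem_zpowers hc
  obtain ⟨y, -, hy⟩ := Nat.exists_mul_mod_eq_one_of_coprime hx Finite.one_lt_card
  obtain ⟨t, hxy⟩ : ∃ t, x * y = Nat.card C * t + 1 := ⟨_, by rw [← hy, Nat.div_add_mod]⟩
  refine ⟨∑ i ∈ Finset.range x, of ℤ C c ^ i, by simp [of_apply],
    ∑ j ∈ Finset.range y, (of ℤ C c ^ x) ^ j, t, ?_⟩
  rw [geom_sum_mul_geom_sum_pow, hxy, Finset.sum_range_succ, ← geom_sum_mul_geom_sum_pow,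
    ← horder, geom_sum_orderOf_eq_normElement hc, pow_mul, ← map_pow, pow_orderOf_eq_one,
    map_one]
  simp [add_comm, mul_comm]

end Cyclic

end UnitModNorm

section Inflation

variable {C G W : Type*} [Group C] [Group G] [Fintype G] [Group W]

/-- The inflation `∑ b_w w ↦ ∑ b_{f g} g` of group ring elements along `f : G → W`. -/
noncomputable def inflation (f : G →* W) : ℤ[W] →+ ℤ[G] where
  toFun E := ∑ g, single g (E.coeff (f g))
  map_zero' := by simp
  map_add' E F := by simp [Finset.sum_add_distrib]

@[simp]
lemma coeff_inflation (f : G →* W) (E : ℤ[W]) (g : G) :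
    (inflation f E).coeff g = E.coeff (f g) := by
  classical
  simp [inflation, Finsupp.single_apply]

lemma mul_inflation (f : G →* W) (H : ℤ[G]) (E : ℤ[W]) :
    H * inflation f E = inflation f (mapDomainRingHom ℤ f H * E) := by
  induction H using MonoidAlgebra.induction_linear with
  | zero => simp
  | add H₁ H₂ h₁ h₂ => simp only [add_mul, map_add, h₁, h₂]
  | single g a => ext; simp [coeff_single_mul_apply]

lemma inflation_mul (f : G →* W) (E : ℤ[W]) (H : ℤ[G]) :
    inflation f E * H = inflation f (E * mapDomainRingHom ℤ f H) := by
  induction H using MonoidAlgebra.induction_linear with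
  | zero => simp
  | add H₁ H₂ h₁ h₂ => simp only [mul_add, map_add, h₁, h₂]
  | single g a => ext; simp [coeff_mul_single_apply]

lemma inflation_normElement [Fintype W] (f : G →* W) :
    inflation f (normElement W) = normElement G := by
  ext; simp [coeff_normElement]

variable (S : GroupExtension C G W)

omit [Fintype G] in
lemma mapDomain_rightHom_mapDomain_inl (H : ℤ[C]) :
    mapDomainRingHom ℤ S.rightHom (mapDomainRingHom ℤ S.inl H) = augmentation C H • 1 := by
  induction H using MonoidAlgebra.induction_linear with
  | zero => simp
  | add H₁ H₂ h₁ h₂ => simp only [map_add, add_smul, h₁, h₂]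
  | single c a => simp [one_def, -zsmul_eq_mul]

lemma mapDomain_inl_normElement [Fintype C] :
    mapDomainRingHom ℤ S.inl (normElement C) = inflation S.rightHom 1 := by
  classical
  ext g
  by_cases hg : S.rightHom g = 1
  · obtain ⟨c, rfl⟩ := exists_mul_inl_eq_of_rightHom_eq S (g := 1) (h := g) (by simp [hg])
    simp [normElement, Finsupp.single_apply, S.inl_injective.eq_iff, one_def]
  · have hne : ∀ c, S.inl c ≠ g := by
      rintro c rfl
      simp at hg
    simp [normElement, hne, hg, one_def]

lemma mapDomain_rightHom_inflation (E : ℤ[W]) :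
    mapDomainRingHom ℤ S.rightHom (inflation S.rightHom E) = (Nat.card C : ℤ) • E := by
  classical
  have := Fintype.ofInjective S.inl S.inl_injective
  ext w
  obtain ⟨g, rfl⟩ := S.rightHom_surjective w
  rw [← augmentation_cosetSlice, augmentation_eq_sum_coeff, coeff_smul]
  simp

end Inflation

section Lift

variable {C G W : Type*} [Group C] [Group G] [Fintype G] [Group W]
  (S : GroupExtension C G W)

/-- The element `a + ∑ b_{f g} g` of `ℤ[G]`, where `E = ∑ b_w w` and `f` is the projection `G → W`;
it lifts `augmentation C a + |C| E` from `ℤ[W]` to `ℤ[G]`. -/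
noncomputable def extensionLift (a : ℤ[C]) (E : ℤ[W]) : ℤ[G] :=
  mapDomainRingHom ℤ S.inl a + inflation S.rightHom E

lemma augmentation_extensionLift (a : ℤ[C]) (E : ℤ[W]) :
    augmentation G (extensionLift S a E) = augmentation C a + Nat.card C * augmentation W E := by
  rw [extensionLift, map_add, augmentation_mapDomain, ← augmentation_mapDomain S.rightHom,
    mapDomain_rightHom_inflation]
  simp

lemma extensionLift_mul_extensionLift (a b : ℤ[C]) (E E' : ℤ[W]) :
    extensionLift S a E * extensionLift S b E' = extensionLift S (a * b)
      (augmentation C a • E' + augmentation C b • E + (Nat.card C : ℤ) • (E * E')) := by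
  simp only [extensionLift, add_mul, mul_add, mul_inflation, inflation_mul, ← map_mul, map_add,
    mapDomain_rightHom_inflation, mapDomain_rightHom_mapDomain_inl, map_zsmul, smul_mul_assoc,
    mul_smul_comm, one_mul, mul_one]
  abel

lemma isUnitModNorm_extensionLift [Fintype C] [Fintype W] {a : ℤ[C]} (ha : IsUnitModNorm a)
    {E : ℤ[W]} (hE : IsUnitModNorm (augmentation C a • 1 + (Nat.card C : ℤ) • E)) :
    IsUnitModNorm (extensionLift S a E) := by
  obtain ⟨b, t, hab⟩ := ha
  have haug : augmentation C a * augmentation C b = 1 + t * Nat.card C := by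
    simpa [augmentation_normElement] using congrArg (augmentation C) hab
  obtain ⟨E', k, hEE'⟩ := exists_mul_eq_one_add_mul_smul_normElement haug hE
  have hcancel : t • 1 + (augmentation C a • E' + augmentation C b • E
      + (Nat.card C : ℤ) • (E * E')) = k • normElement W := by
    refine smul_right_injective _ (Nat.cast_ne_zero.mpr Nat.card_pos.ne' : (Nat.card C : ℤ) ≠ 0) ?_
    simp only [add_mul, mul_add, smul_mul_assoc, mul_smul_comm, one_mul, mul_one] at hEE'
    linear_combination (norm := module) hEE' - haug • (1 : ℤ[W])
  refine ⟨extensionLift S b E', k, ?_⟩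
  rw [extensionLift_mul_extensionLift, hab, extensionLift, map_add, map_one, map_zsmul,
    mapDomain_inl_normElement, add_assoc, ← map_zsmul, ← map_add, hcancel, map_zsmul,
    inflation_normElement]

end Lift

section LiftPrime

variable {p : ℕ} [hp : Fact p.Prime] {C G W : Type*} [CommGroup C] [Group G] [Fintype G]
  [Group W]

lemma prime_dvd_extensionLift_pow_sub (hcard : Nat.card C = p) (S : GroupExtension C G W)
    (a : ℤ[C]) (E : ℤ[W]) :
    (p : ℤ[G]) ∣ extensionLift S a E ^ p - (augmentation C a : ℤ[G]) := by
  have hcomm : Commute (mapDomainRingHom ℤ S.inl a) (inflation S.rightHom E) := by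
    rw [commute_iff_eq, mul_inflation, inflation_mul, mapDomain_rightHom_mapDomain_inl,
      smul_one_mul, mul_smul_one]
  have hsq : (p : ℤ[G]) ∣ inflation S.rightHom E ^ 2 := by
    rw [sq, inflation_mul, mapDomain_rightHom_inflation, hcard, mul_smul_comm, map_zsmul]
    exact ⟨inflation S.rightHom (E * E), by simp⟩
  have hfrob : (p : ℤ[G]) ∣ mapDomainRingHom ℤ S.inl a ^ p - (augmentation C a : ℤ[G]) := by
    simpa only [map_sub, map_pow, map_natCast, map_intCast] using map_dvd (mapDomainRingHom ℤ S.inl)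
      (prime_dvd_pow_sub_augmentation (fun c => hcard ▸ pow_card_eq_one') a)
  obtain ⟨r, hr⟩ := hcomm.exists_add_pow_prime_eq hp.out
  rw [extensionLift, hr, add_assoc, add_sub_right_comm]
  refine dvd_add hfrob (dvd_add (hsq.trans (pow_dvd_pow _ hp.out.two_le)) ?_)
  simp only [mul_assoc]
  exact dvd_mul_right _ _

lemma exists_isUnitModNorm_lift [Fintype W] (hcard : Nat.card C = p) (S : GroupExtension C G W)
    {x : ℕ} (hpx : x.Coprime p) {F : ℤ[W]} (hF : IsUnitModNorm F) (haug : augmentation W F = x)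
    (hdvd : (p : ℤ[W]) ∣ F - (x : ℤ[W])) :
    ∃ F' : ℤ[G], IsUnitModNorm F' ∧ augmentation G F' = x ∧ (p : ℤ[G]) ∣ F' ^ p - (x : ℤ[G]) := by
  classical
  have := Fintype.ofInjective S.inl S.inl_injective
  have : IsCyclic C := isCyclic_of_prime_card hcard
  have : Nontrivial C := Finite.one_lt_card_iff_nontrivial.mp (hcard ▸ hp.out.one_lt)
  obtain ⟨a, ha, hunit⟩ := exists_isUnitModNorm_of_isCyclic (hcard.symm ▸ hpx)
  obtain ⟨E, hE⟩ := hdvd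
  have hFE : F = augmentation C a • 1 + (Nat.card C : ℤ) • E := by
    rw [ha, hcard, zsmul_one, natCast_zsmul, nsmul_eq_mul, ← hE]
    simp
  have haugE : (p : ℤ) * augmentation W E = 0 := by
    simpa [haug] using (congrArg (augmentation W) hE).symm
  refine ⟨extensionLift S a E, isUnitModNorm_extensionLift S hunit (hFE ▸ hF), ?_, ?_⟩
  · rw [augmentation_extensionLift, ha, hcard, haugE, add_zero]
  · simpa [ha] using prime_dvd_extensionLift_pow_sub hcard S a E

end LiftPrime

section Existence

universe u

lemma exists_isUnitModNorm_dvd_sub {p n x : ℕ} [hp : Fact p.Prime] (hpx : x.Coprime p)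
    (hx : x ^ p ≡ x [MOD p ^ (n + 1)]) {G : Type u} [Group G] [Fintype G]
    (hcard : Nat.card G = p ^ n) :
    ∃ F : ℤ[G], IsUnitModNorm F ∧ augmentation G F = x ∧ (p : ℤ[G]) ∣ F - (x : ℤ[G]) := by
  induction n generalizing G with
  | zero =>
    have := (Nat.card_eq_one_iff_unique.mp hcard).1
    refine ⟨x, ⟨0, -1, ?_⟩, by simp, by simp⟩
    rw [mul_zero, normElement, Fintype.sum_subsingleton _ 1]
    simp [one_def]
  | succ n ih =>
    obtain ⟨C, W, _, _, S, hC, hW, -⟩ := exists_central_extension hcard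
    classical
    have := Fintype.ofInjective S.inl S.inl_injective
    have := Fintype.ofSurjective S.rightHom S.rightHom_surjective
    obtain ⟨E, hE, haug, hdvd⟩ := ih (hx.of_dvd (pow_dvd_pow p (n + 1).le_succ)) hW
    obtain ⟨F, hF, haug, hdvd⟩ := exists_isUnitModNorm_lift hC S hpx hE haug hdvd
    obtain ⟨k, hk⟩ : ((p ^ (n + 1 + 1) : ℕ) : ℤ) ∣ x - x ^ p := by
      exact_mod_cast (Int.natCast_modEq_iff.mpr hx).dvd
    -- `F ^ p` is congruent to `x` but has augmentation `x ^ p`, a multiple of `p ^ (n + 2)` away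
    -- from `x`; a multiple of the norm element corrects this.
    refine ⟨F ^ p + (p * k) • normElement G, (hF.pow p).add_smul_normElement _, ?_, ?_⟩
    · rw [map_add, map_pow, map_zsmul, haug, augmentation_normElement, ← Nat.card_eq_fintype_card,
        hcard]
      push_cast at hk ⊢
      linear_combination -hk
    · rw [add_sub_right_comm]
      exact dvd_add hdvd ⟨k • normElement G, by simp [mul_assoc]⟩

theorem exists_natAbs_groupDet_eq {p n x : ℕ} [hp : Fact p.Prime] (hn : n ≠ 0)
    (hx : x ^ (p - 1) ≡ 1 [MOD p ^ n]) {G : Type*} [Group G] [Fintype G] [DecidableEq G]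
    (hcard : Nat.card G = p ^ n) : ∃ F : ℤ[G], (groupDet F).natAbs = x := by
  obtain ⟨n, rfl⟩ := Nat.exists_eq_succ_of_ne_zero hn
  have hpx : x.Coprime p := by
    refine (Nat.coprime_of_mul_modEq_one (x ^ (p - 1 - 1)) ?_).coprime_dvd_right
      (dvd_pow_self p n.succ_ne_zero)
    rwa [mul_pow_sub_one (Nat.sub_ne_zero_of_lt hp.out.one_lt)]
  have hxp : x ^ p ≡ x [MOD p ^ (n + 1)] := by
    simpa [← pow_succ, Nat.sub_add_cancel hp.out.one_le] using hx.mul_right x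
  classical
  have : Nontrivial G := Finite.one_lt_card_iff_nontrivial.mp
    (hcard ▸ Nat.one_lt_pow n.succ_ne_zero hp.out.one_lt)
  obtain ⟨C, W, _, _, S, hC, hW, -⟩ := exists_central_extension hcard
  have := Fintype.ofInjective S.inl S.inl_injective
  have := Fintype.ofSurjective S.rightHom S.rightHom_surjective
  -- The congruence modulo `p` is needed on the quotient only, hence the exponent `n` in `hx`.
  obtain ⟨E, hE, haug, hdvd⟩ := exists_isUnitModNorm_dvd_sub hpx hxp hW
  obtain ⟨F, hF, haug, -⟩ := exists_isUnitModNorm_lift hC S hpx hE haug hdvd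
  exact ⟨F, by rw [hF.natAbs_groupDet, haug, Int.natAbs_natCast]⟩

end Existence

section LindLehmer

lemma lindLehmer_eq_of_isLeast {G : Type*} [Group G] [Fintype G] [DecidableEq G]
    {m : ℕ} (hm : IsLeast (nontrivialAbsDets G) m) :
    lindLehmer G = 1 / (Nat.card G : ℝ) * Real.log m := by
  rw [lindLehmer, hm.csInf_eq, Nat.card_eq_fintype_card]

lemma sub_one_pow_modEq_one {k N : ℕ} (hk : Even k) (hN : N ≠ 0) :
    (N - 1) ^ k ≡ 1 [MOD N] := by
  refine (Nat.modEq_iff_dvd.mpr ?_).symm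
  have h := sub_dvd_pow_sub_pow ((N : ℤ) - 1) (-1) k
  rw [hk.neg_one_pow] at h
  simpa [Nat.cast_sub (Nat.one_le_iff_ne_zero.mpr hN)] using h

variable {p n : ℕ} [hp : Fact p.Prime]

lemma prime_pow_sub_one_mem (hodd : p ≠ 2) (hn : n ≠ 0) :
    p ^ n - 1 ∈ {x | 2 ≤ x ∧ x ^ (p - 1) ≡ 1 [MOD p ^ n]} := by
  have hp3 : 3 ≤ p := hp.out.two_le.lt_of_ne' hodd
  have hpn : p ≤ p ^ n := Nat.le_self_pow hn p
  exact ⟨by omega, sub_one_pow_modEq_one (hp.out.even_sub_one hodd) (by omega)⟩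

lemma isLeast_nontrivialAbsDets (hodd : p ≠ 2) (hn : n ≠ 0) {G : Type*} [Group G]
    [Fintype G] [DecidableEq G] (hG : ∀ g : G, g ^ p = 1) (hcard : Nat.card G = p ^ n) {m : ℕ}
    (hm : IsLeast {x | 2 ≤ x ∧ x ^ (p - 1) ≡ 1 [MOD p ^ n]} m) :
    IsLeast (nontrivialAbsDets G) m := by
  refine ⟨⟨hm.1.1, exists_natAbs_groupDet_eq hn hm.1.2 hcard⟩, ?_⟩
  rintro _ ⟨hF, F, rfl⟩
  rcases pow_dvd_natAbs_groupDet_or_pow_modEq_one hodd hG hcard F with hdvd | hmod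
  · calc m ≤ p ^ n - 1 := hm.2 (prime_pow_sub_one_mem hodd hn)
      _ ≤ p ^ n := Nat.sub_le _ _
      _ ≤ (groupDet F).natAbs := Nat.le_of_dvd (by omega) hdvd
  · exact hm.2 ⟨hF, hmod⟩

theorem mainTheorem7_general (hodd : p ≠ 2) (hn : n ≠ 0)
    {G : Type*} [Group G] [Fintype G] [DecidableEq G]
    {A : Type*} [Group A] [Fintype A] [DecidableEq A]
    (hG : ∀ g : G, g ^ p = 1) (hA : ∀ a : A, a ^ p = 1)
    (hcardG : Nat.card G = p ^ n) (hcardA : Nat.card A = p ^ n) :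
    lindLehmer G = lindLehmer A ∧
    ∃ m : ℕ,
      IsLeast {x : ℕ | 2 ≤ x ∧ x ^ (p - 1) ≡ 1 [MOD p ^ n]} m ∧
      lindLehmer A = 1 / (p : ℝ) ^ n * Real.log (m : ℝ) ∧
      IsLeast (nontrivialAbsDets G) m ∧
      IsLeast (nontrivialAbsDets A) m := by
  obtain ⟨m, hm⟩ : ∃ m, IsLeast {x | 2 ≤ x ∧ x ^ (p - 1) ≡ 1 [MOD p ^ n]} m :=
    ⟨_, Nat.sInf_mem ⟨_, prime_pow_sub_one_mem hodd hn⟩, fun _ hx => Nat.sInf_le hx⟩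
  have hmG := isLeast_nontrivialAbsDets hodd hn hG hcardG hm
  have hmA := isLeast_nontrivialAbsDets hodd hn hA hcardA hm
  refine ⟨?_, m, hm, ?_, hmG, hmA⟩
  · rw [lindLehmer_eq_of_isLeast hmG, lindLehmer_eq_of_isLeast hmA, hcardG, hcardA]
  · rw [lindLehmer_eq_of_isLeast hmA, hcardA, Nat.cast_pow]

end LindLehmer

section Heisenberg

variable {R : Type*} [CommRing R]

/-- The coordinates `(a, b, c)` of the element `!![1, a, c; 0, 1, b; 0, 0, 1]`. -/
def heisenbergEquiv : heisenberg R ≃ R × R × R where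
  toFun M := (M.1.1 0 1, M.1.1 1 2, M.1.1 0 2)
  invFun u := ⟨⟨!![1, u.1, u.2.2; 0, 1, u.2.1; 0, 0, 1], by simp [Matrix.det_fin_three]⟩,
    u.1, u.2.1, u.2.2, rfl⟩
  left_inv := by
    rintro ⟨M, a, b, c, h⟩
    apply Subtype.ext
    apply Subtype.ext
    simp [h]
  right_inv u := by simp

variable (R) in
lemma natCard_heisenberg : Nat.card (heisenberg R) = Nat.card R ^ 3 := by
  simp [Nat.card_congr heisenbergEquiv, Nat.card_prod, pow_three]

lemma unitriangular_pow (a b c : R) (k : ℕ) :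
    !![1, a, c; 0, 1, b; 0, 0, 1] ^ k
      = !![1, k * a, k * c + k.choose 2 * (a * b); 0, 1, k * b; 0, 0, 1] := by
  induction k with
  | zero => ext i j; fin_cases i <;> fin_cases j <;> simp
  | succ k ih =>
    rw [pow_succ, ih, Nat.choose_succ_succ' k 1, Nat.choose_one_right]
    ext i j
    fin_cases i <;> fin_cases j <;> simp [Matrix.mul_apply, Fin.sum_univ_three] <;> ring

lemma heisenberg_pow_eq_one {p : ℕ} [CharP R p] (hodd : Odd p) (g : heisenberg R) : g ^ p = 1 := by
  obtain ⟨M, a, b, c, hM⟩ := g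
  have hchoose : (p.choose 2 : R) = 0 := by
    rw [CharP.cast_eq_zero_iff R p, Nat.choose_two_right,
      Nat.mul_div_assoc _ (hodd.tsub_odd odd_one).two_dvd]
    exact dvd_mul_right _ _
  apply Subtype.ext
  apply Subtype.ext
  rw [Subgroup.coe_pow, Matrix.SpecialLinearGroup.coe_pow, hM, unitriangular_pow]
  simp [hchoose, Matrix.one_fin_three]

end Heisenberg

lemma multiplicative_pow_charP_eq_one {ι R : Type*} [NonAssocSemiring R] {p : ℕ} [CharP R p]
    (f : Multiplicative (ι → R)) : f ^ p = 1 := by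
  apply Multiplicative.toAdd.injective
  ext i
  simp

theorem mainTheorem7 (p : ℕ) [Fact p.Prime] (hp : 3 ≤ p) :
    lindLehmer (heisenberg (ZMod p)) = lindLehmer (Multiplicative (Fin 3 → ZMod p)) ∧
    ∃ m : ℕ,
      IsLeast {x : ℕ | 2 ≤ x ∧ x ^ (p - 1) ≡ 1 [MOD p ^ 3]} m ∧
      lindLehmer (Multiplicative (Fin 3 → ZMod p)) = 1 / (p : ℝ) ^ 3 * Real.log (m : ℝ) ∧
      IsLeast (nontrivialAbsDets (heisenberg (ZMod p))) m ∧
      IsLeast (nontrivialAbsDets (Multiplicative (Fin 3 → ZMod p))) m := by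
  have hodd : p ≠ 2 := by omega
  exact mainTheorem7_general hodd three_ne_zero
    (heisenberg_pow_eq_one (Nat.Prime.odd_of_ne_two Fact.out hodd)) multiplicative_pow_charP_eq_one
    (by rw [natCard_heisenberg, Nat.card_zmod]) (by simp)
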